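/- For $f\in L^1(\mathbb R)$, $\varepsilon>0$ and $x\in\mathbb R$ let \[ H_\varepsilon f(x)=\frac1\pi\int_{|t-x|>\varepsilon}\frac{f(t)}{x-t}\,dt, \qquad H^*f(x)=\sup_{\varepsilon>0}|H_\varepsilon f(x)|\in[0,\infty] \] be the truncated and the maximal Hilbert transform. For every closed set $e\subset\mathbb R$ of Lebesgue measure zero there exists a continuous integrable function $f:\mathbb R\to\mathbb R$, that is $f\in C(\mathbb R)\cap L^1(\mathbb R)$, such that $H^*f(x)=\infty$ for every $x\in e$. -/

import Mathlib

open MeasureTheory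

open scoped ENNReal

/-- The truncated Hilbert transform
`H_ε f (x) = (1/π) ∫_{|t - x| > ε} f(t) / (x - t) dt` of a real function on the line.
For integrable `f` and `ε > 0` the integral converges absolutely. -/
noncomputable def truncatedHilbert (ε : ℝ) (f : ℝ → ℝ) (x : ℝ) : ℝ :=
  1 / Real.pi * ∫ t in {t : ℝ | ε < |t - x|}, f t / (x - t)

/-- The maximal Hilbert transform `H^* f (x) = sup_{ε > 0} |H_ε f (x)|`, with values in
`[0, ∞]`. -/
noncomputable def maximalHilbert (f : ℝ → ℝ) (x : ℝ) : ℝ≥0∞ :=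
  ⨆ (ε : ℝ) (_ : 0 < ε), ENNReal.ofReal |truncatedHilbert ε f x|

theorem measurableSet_truncation (ε x : ℝ) : MeasurableSet {t : ℝ | ε < |t - x|} :=
  (isOpen_lt continuous_const (by fun_prop)).measurableSet

theorem integrableOn_truncation {f : ℝ → ℝ} (hf : Integrable f) {ε : ℝ} (hε : 0 < ε) (x : ℝ) :
    IntegrableOn (fun t => f t / (x - t)) {t : ℝ | ε < |t - x|} := by
  refine Integrable.mono' (g := fun t => |f t| / ε) (hf.abs.div_const ε).integrableOn ?_ ?_
  · exact (hf.aestronglyMeasurable.aemeasurable.div (by fun_prop)).aestronglyMeasurable.restrict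
  · refine (ae_restrict_iff' (measurableSet_truncation ε x)).2 (.of_forall fun t ht => ?_)
    have ht : ε < |t - x| := ht
    rw [Real.norm_eq_abs, abs_div, abs_sub_comm x t]
    gcongr

theorem abs_truncatedHilbert_le {f : ℝ → ℝ} (hf : Integrable f) {ε : ℝ} (hε : 0 < ε) (x : ℝ) :
    |truncatedHilbert ε f x| ≤ (∫ t, |f t|) / (Real.pi * ε) := by
  have h1 : |∫ t in {t : ℝ | ε < |t - x|}, f t / (x - t)| ≤ (∫ t, |f t|) / ε := by
    calc |∫ t in {t : ℝ | ε < |t - x|}, f t / (x - t)|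
        ≤ ∫ t in {t : ℝ | ε < |t - x|}, |f t / (x - t)| := abs_integral_le_integral_abs
      _ ≤ ∫ t in {t : ℝ | ε < |t - x|}, |f t| / ε := by
          refine setIntegral_mono_on (integrableOn_truncation hf hε x).abs
            (hf.abs.div_const ε).integrableOn (measurableSet_truncation ε x) fun t ht => ?_
          have ht : ε < |t - x| := ht
          rw [abs_div, abs_sub_comm x t]
          gcongr
      _ ≤ ∫ t, |f t| / ε :=
          setIntegral_le_integral (hf.abs.div_const ε) (.of_forall fun t => by positivity)
      _ = _ := integral_div _ _
  rw [truncatedHilbert, abs_mul, abs_of_pos (by positivity : 0 < 1 / Real.pi)]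
  calc 1 / Real.pi * _ ≤ 1 / Real.pi * ((∫ t, |f t|) / ε) := by gcongr
    _ = _ := by field_simp

theorem truncatedHilbert_add {f g : ℝ → ℝ} (hf : Integrable f) (hg : Integrable g) {ε : ℝ}
    (hε : 0 < ε) (x : ℝ) :
    truncatedHilbert ε (fun t => f t + g t) x
      = truncatedHilbert ε f x + truncatedHilbert ε g x := by
  simp only [truncatedHilbert, add_div]
  rw [integral_add (integrableOn_truncation hf hε x) (integrableOn_truncation hg hε x), mul_add]

theorem truncatedHilbert_const_mul (c : ℝ) (f : ℝ → ℝ) (ε x : ℝ) :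
    truncatedHilbert ε (fun t => c * f t) x = c * truncatedHilbert ε f x := by
  simp only [truncatedHilbert, mul_div_assoc]
  rw [integral_const_mul]
  ring

theorem truncatedHilbert_sub {f g : ℝ → ℝ} (hf : Integrable f) (hg : Integrable g) {ε : ℝ}
    (hε : 0 < ε) (x : ℝ) :
    truncatedHilbert ε (fun t => f t - g t) x
      = truncatedHilbert ε f x - truncatedHilbert ε g x := by
  simp only [truncatedHilbert, sub_div]
  rw [integral_sub (integrableOn_truncation hf hε x) (integrableOn_truncation hg hε x), mul_sub]

theorem abs_truncatedHilbert_sub_le {f g : ℝ → ℝ} (hf : Integrable f) (hg : Integrable g) {ε : ℝ}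
    (hε : 0 < ε) (x : ℝ) :
    |truncatedHilbert ε f x - truncatedHilbert ε g x| ≤ (∫ t, |f t - g t|) / (Real.pi * ε) := by
  rw [← truncatedHilbert_sub hf hg hε]
  exact abs_truncatedHilbert_le (hf.sub hg) hε x

theorem measurableSet_annulus (ε x : ℝ) : MeasurableSet {t : ℝ | ε < |t - x| ∧ |t - x| ≤ 1} :=
  (measurableSet_truncation ε x).inter
    (isClosed_le (f := fun t : ℝ => |t - x|) (by fun_prop) continuous_const).measurableSet

theorem setIntegral_inv_annulus_eq_zero (ε x : ℝ) :
    ∫ t in {t : ℝ | ε < |t - x| ∧ |t - x| ≤ 1}, 1 / (x - t) = 0 := by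
  rw [← integral_indicator (measurableSet_annulus ε x)]
  set φ := Set.indicator {t : ℝ | ε < |t - x| ∧ |t - x| ≤ 1} (fun t => 1 / (x - t)) with hφ
  have h1 : ∀ t, φ (2 * x - t) = - φ t := by
    intro t
    have e1 : |2 * x - t - x| = |t - x| := by rw [← abs_neg]; congr 1; ring
    have e2 : x - (2 * x - t) = -(x - t) := by ring
    simp only [hφ, Set.indicator_apply, Set.mem_ofPred_eq, e1, e2]
    split_ifs
    · rw [div_neg]
    · simp
  have h2 : ∫ t, φ (2 * x - t) = ∫ t, φ t := integral_sub_left_eq_self φ volume (2 * x)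
  simp only [h1, integral_neg] at h2
  linarith

theorem abs_setIntegral_annulus_le {f : ℝ → ℝ} {L : NNReal} (hL : LipschitzWith L f)
    (hf : Integrable f) {ε : ℝ} (hε : 0 < ε) (x : ℝ) :
    |∫ t in {t : ℝ | ε < |t - x| ∧ |t - x| ≤ 1}, f t / (x - t)| ≤ 2 * L := by
  set S := {t : ℝ | ε < |t - x| ∧ |t - x| ≤ 1} with hS
  have hsub : S ⊆ Set.Icc (x - 1) (x + 1) := fun t ht => by
    have := abs_le.1 ht.2
    constructor <;> linarith
  have hv : volume S ≤ ENNReal.ofReal 2 := by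
    refine (measure_mono hsub).trans ?_
    rw [Real.volume_Icc]
    ring_nf; rfl
  have hfin : volume S < ∞ := hv.trans_lt ENNReal.ofReal_lt_top
  have hi1 : IntegrableOn (fun t => f t / (x - t)) S :=
    (integrableOn_truncation hf hε x).mono_set fun t ht => ht.1
  have hi2 : IntegrableOn (fun t => f x * (1 / (x - t))) S := by
    refine Integrable.const_mul ?_ _
    have := integrableOn_truncation (f := S.indicator 1) (ε := ε) (x := x) ?_ hε
    · refine (this.mono_set (t := {t : ℝ | ε < |t - x|}) (s := S) fun t ht => ht.1).congr_fun
        (fun t ht => ?_) ?_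
      · simp [ht]
      · exact measurableSet_annulus ε x
    · refine (integrable_indicator_iff ?_).2 ?_
      · exact measurableSet_annulus ε x
      · exact integrableOn_const hfin.ne
  have key : ∫ t in S, f t / (x - t) = ∫ t in S, (f t / (x - t) - f x * (1 / (x - t))) := by
    rw [integral_sub hi1 hi2, integral_const_mul, setIntegral_inv_annulus_eq_zero]
    simp
  rw [key]
  have hb : ∀ t ∈ S, ‖f t / (x - t) - f x * (1 / (x - t))‖ ≤ (L : ℝ) := by
    intro t ht
    have hpos : 0 < |x - t| := by rw [abs_sub_comm]; exact hε.trans ht.1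
    have := hL.dist_le_mul t x
    rw [Real.dist_eq, Real.dist_eq, abs_sub_comm t x] at this
    rw [mul_one_div, ← sub_div, Real.norm_eq_abs, abs_div, div_le_iff₀ hpos]
    exact this
  refine (norm_setIntegral_le_of_norm_le_const hfin hb).trans ?_
  rw [mul_comm]
  gcongr
  exact ENNReal.toReal_le_of_le_ofReal (by norm_num) hv

theorem LipschitzWith.abs_truncatedHilbert_le {f : ℝ → ℝ} {L : NNReal} (hL : LipschitzWith L f)
    (hf : Integrable f) {ε : ℝ} (hε : 0 < ε) (x : ℝ) :
    |truncatedHilbert ε f x| ≤ (2 * L + ∫ t, |f t|) / Real.pi := by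
  have hI : 0 ≤ ∫ t, |f t| := integral_nonneg fun t => abs_nonneg _
  have h1 := _root_.abs_truncatedHilbert_le hf (ε := max ε 1) (by positivity) x
  have hsplit : {t : ℝ | ε < |t - x|}
      = {t : ℝ | ε < |t - x| ∧ |t - x| ≤ 1} ∪ {t : ℝ | max ε 1 < |t - x|} := by
    ext t
    simp only [Set.mem_ofPred_eq, Set.mem_union, max_lt_iff]
    constructor
    · intro h
      rcases le_or_gt (|t - x|) 1 with h' | h'
      · exact .inl ⟨h, h'⟩
      · exact .inr ⟨h, h'⟩
    · rintro (h | h) <;> exact h.1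
  have h2 : truncatedHilbert ε f x
      = 1 / Real.pi * (∫ t in {t : ℝ | ε < |t - x| ∧ |t - x| ≤ 1}, f t / (x - t))
        + truncatedHilbert (max ε 1) f x := by
    rw [truncatedHilbert, hsplit, setIntegral_union, mul_add, truncatedHilbert]
    · rw [Set.disjoint_left]
      intro t ht ht'
      exact absurd ht.2 (not_le.2 (max_lt_iff.1 ht').2)
    · exact measurableSet_truncation _ x
    · exact (integrableOn_truncation hf hε x).mono_set fun t ht => ht.1
    · exact integrableOn_truncation hf (by positivity) x
  have h3 := abs_setIntegral_annulus_le hL hf hε x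
  rw [h2]
  refine (abs_add_le _ _).trans ?_
  rw [add_div]
  refine add_le_add ?_ (h1.trans ?_)
  · rw [abs_mul, abs_of_pos (by positivity : 0 < 1 / Real.pi), one_div, inv_mul_eq_div]
    gcongr
  · gcongr
    nlinarith [le_max_right ε 1, Real.pi_pos]
open Filter Topology in
theorem IsCompact.exists_finset_card_mul_le {K : Set ℝ} (hK : IsCompact K) (h0 : volume K = 0)
    {δ : ℝ} (hδ : 0 < δ) :
    ∃ (A : Finset ℝ) (h : ℝ), 0 < h ∧ A.card * h ≤ δ ∧ ∀ x ∈ K, ∃ a ∈ A, |x - a| ≤ h := by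
  have ht : Tendsto (fun r => volume (Metric.cthickening r K)) (𝓝[>] 0) (𝓝 0) := by
    have := tendsto_measure_cthickening_of_isCompact (μ := volume) hK
    rw [h0] at this
    exact this.mono_left nhdsWithin_le_nhds
  obtain ⟨h, hh, hpos⟩ := ((ht.eventually_lt_const (u := ENNReal.ofReal δ) (by simpa)).and
    self_mem_nhdsWithin).exists
  have hpos : 0 < h := hpos
  have hfin : ((fun x : ℝ => ⌊x / h⌋) '' K).Finite := by
    obtain ⟨B, hB⟩ := hK.isBounded.exists_norm_le
    refine (Set.finite_Icc ⌊-B / h⌋ ⌊B / h⌋).subset ?_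
    rintro _ ⟨x, hx, rfl⟩
    have := abs_le.1 (hB x hx)
    constructor <;> refine Int.floor_le_floor ?_ <;> gcongr <;> linarith
  refine ⟨hfin.toFinset.image fun j : ℤ => (j : ℝ) * h, h, hpos, ?_, fun x hx => ?_⟩
  · set J := hfin.toFinset
    have hsub : (⋃ j ∈ J, Set.Ico ((j : ℝ) * h) ((j + 1 : ℝ) * h)) ⊆ Metric.cthickening h K := by
      intro t ht
      simp only [Set.mem_iUnion] at ht
      obtain ⟨j, hj, ht⟩ := ht
      obtain ⟨x, hx, rfl⟩ := (Set.Finite.mem_toFinset _).1 hj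
      refine Metric.mem_cthickening_of_dist_le t x h K hx ?_
      have h1 := (le_div_iff₀ hpos).1 (Int.floor_le (x / h))
      have h2 := (div_lt_iff₀ hpos).1 (Int.lt_floor_add_one (x / h))
      rw [Real.dist_eq, abs_le]
      have := ht.1; have := ht.2
      constructor <;> nlinarith
    have hd : (J : Set ℤ).PairwiseDisjoint
        fun j : ℤ => Set.Ico ((j : ℝ) * h) ((j + 1 : ℝ) * h) := by
      intro i _ j _ hij
      refine Set.disjoint_left.2 fun t hi hj => hij ?_
      have h1 : (i : ℝ) < j + 1 := lt_of_mul_lt_mul_right (hi.1.trans_lt hj.2) hpos.le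
      have h2 : (j : ℝ) < i + 1 := lt_of_mul_lt_mul_right (hj.1.trans_lt hi.2) hpos.le
      norm_cast at h1 h2
      omega
    have hm := measure_biUnion_finset (μ := volume) hd fun j _ => measurableSet_Ico
    have hv : volume (⋃ j ∈ J, Set.Ico ((j : ℝ) * h) ((j + 1 : ℝ) * h))
        = ENNReal.ofReal (J.card * h) := by
      have e1 : ∀ j : ℤ, ((j + 1 : ℝ) * h) - j * h = h := fun j => by ring
      rw [hm]
      simp only [Real.volume_Ico, e1, Finset.sum_const, nsmul_eq_mul]
      rw [ENNReal.ofReal_mul (by positivity)]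
      simp
    have hlt := (measure_mono hsub).trans hh.le
    rw [hv, ENNReal.ofReal_le_ofReal_iff hδ.le] at hlt
    refine le_trans ?_ hlt
    gcongr
    exact Finset.card_image_le
  · refine ⟨⌊x / h⌋ * h, Finset.mem_image.2 ⟨_, (Set.Finite.mem_toFinset _).2 ⟨x, hx, rfl⟩, rfl⟩, ?_⟩
    have h1 := (le_div_iff₀ hpos).1 (Int.floor_le (x / h))
    have h2 := (div_lt_iff₀ hpos).1 (Int.lt_floor_add_one (x / h))
    rw [abs_le]
    constructor <;> nlinarith
open Filter Topology in
theorem exists_interlacing_root (A : Finset ℝ) {c : ℝ} (hc : 0 < c) {a : ℝ} (ha : a ∈ A) :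
    ∃ b, a < b ∧ (∀ a' ∈ A, a < a' → b < a') ∧ ∑ a' ∈ A, c / (b - a') = 1 := by
  set R : ℝ → ℝ := fun t => ∑ a' ∈ A, c / (t - a') with hR
  have hsplit : ∀ u ∈ A, R = fun t => c / (t - u) + ∑ a' ∈ A.erase u, c / (t - a') := by
    intro u hu
    funext t
    exact (Finset.add_sum_erase A (fun a' => c / (t - a')) hu).symm
  have hcont : ∀ u, ContinuousAt (fun t : ℝ => ∑ a' ∈ A.erase u, c / (t - a')) u := by
    intro u
    refine tendsto_finsetSum _ fun a' ha' => ?_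
    have : u - a' ≠ 0 := sub_ne_zero.2 (Finset.ne_of_mem_erase ha').symm
    have h : ContinuousAt (fun t : ℝ => c / (t - a')) u := by fun_prop (disch := assumption)
    exact h
  have hright : ∀ u ∈ A, Tendsto R (𝓝[>] u) atTop := by
    intro u hu
    rw [hsplit u hu]
    refine Tendsto.atTop_add (C := ∑ a' ∈ A.erase u, c / (u - a')) ?_
      ((hcont u).tendsto.mono_left nhdsWithin_le_nhds)
    simp only [div_eq_mul_inv]
    refine Tendsto.const_mul_atTop hc (tendsto_inv_nhdsGT_zero.comp ?_)
    refine tendsto_nhdsWithin_iff.2 ⟨?_, ?_⟩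
    · exact ((by fun_prop : Continuous fun t : ℝ => t - u).tendsto' u 0 (sub_self u)).mono_left
        nhdsWithin_le_nhds
    · filter_upwards [self_mem_nhdsWithin] with t ht using sub_pos.2 (Set.mem_Ioi.1 ht)
  have hleft : ∀ u ∈ A, Tendsto R (𝓝[<] u) atBot := by
    intro u hu
    rw [hsplit u hu]
    refine Tendsto.atBot_add (C := ∑ a' ∈ A.erase u, c / (u - a')) ?_
      ((hcont u).tendsto.mono_left nhdsWithin_le_nhds)
    simp only [div_eq_mul_inv]
    refine Tendsto.const_mul_atBot hc (tendsto_inv_nhdsLT_zero.comp ?_)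
    refine tendsto_nhdsWithin_iff.2 ⟨?_, ?_⟩
    · exact ((by fun_prop : Continuous fun t : ℝ => t - u).tendsto' u 0 (sub_self u)).mono_left
        nhdsWithin_le_nhds
    · filter_upwards [self_mem_nhdsWithin] with t ht using sub_neg.2 (Set.mem_Iio.1 ht)
  have hinf : Tendsto R atTop (𝓝 0) := by
    rw [← Finset.sum_const_zero (s := A) (M := ℝ)]
    refine tendsto_finsetSum _ fun a' _ => ?_
    exact Tendsto.const_div_atTop (tendsto_atTop_add_const_right _ _ tendsto_id) c
  have hcs : ∀ s : Set ℝ, (∀ t ∈ s, t ∉ A) → ContinuousOn R s := by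
    intro s hs
    refine continuousOn_finsetSum _ fun a' ha' => ?_
    refine continuousOn_const.div (by fun_prop) fun t ht h => hs t ht ?_
    rwa [sub_eq_zero.1 h]
  rcases (A.filter (a < ·)).eq_empty_or_nonempty with hemp | hne
  · have hno : ∀ t ∈ Set.Ioi a, t ∉ A := fun t ht htA => by
      have : t ∈ A.filter (a < ·) := Finset.mem_filter.2 ⟨htA, ht⟩
      simp [hemp] at this
    obtain ⟨b, hb, hb1⟩ := (isPreconnected_Ioi (a := a)).intermediate_value_Ioi
      (l₁ := atTop) (l₂ := 𝓝[>] a) (le_principal_iff.2 (Ioi_mem_atTop a))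
      (le_principal_iff.2 self_mem_nhdsWithin) (hcs _ hno) hinf (hright a ha)
      (Set.mem_Ioi.2 one_pos)
    exact ⟨b, hb, fun a' ha' haa' => absurd ha' (hno a' haa'), hb1⟩
  · set u := (A.filter (a < ·)).min' hne with hu
    obtain ⟨huA, hau⟩ := Finset.mem_filter.1 ((A.filter (a < ·)).min'_mem hne)
    have hmin : ∀ t ∈ A, a < t → u ≤ t := fun t ht hat =>
      Finset.min'_le _ _ (Finset.mem_filter.2 ⟨ht, hat⟩)
    have hno : ∀ t ∈ Set.Ioo a u, t ∉ A := fun t ht htA => absurd (hmin t htA ht.1) (not_le.2 ht.2)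
    obtain ⟨b, hb, hb1⟩ := (isPreconnected_Ioo (a := a) (b := u)).intermediate_value_Iii
      (l₁ := 𝓝[<] u) (l₂ := 𝓝[>] a) (le_principal_iff.2 (Ioo_mem_nhdsLT hau))
      (le_principal_iff.2 (Ioo_mem_nhdsGT hau)) (hcs _ hno) (hleft u huA) (hright a ha)
      (Set.mem_univ (1 : ℝ))
    exact ⟨b, hb.1, fun a' ha' haa' => hb.2.trans_le (hmin a' ha' haa'), hb1⟩

open Polynomial in
theorem exists_interlacing_factorization (A : Finset ℝ) {c : ℝ} (hc : 0 < c) :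
    ∃ b : ℝ → ℝ, (∀ a ∈ A, a < b a) ∧ (∀ a ∈ A, ∀ a' ∈ A, a < a' → b a < a') ∧
      ∑ a ∈ A, (b a - a) = A.card * c ∧
      ∏ a ∈ A, (X - C (b a)) = ∏ a ∈ A, (X - C a) - ∑ a ∈ A, C c * ∏ a' ∈ A.erase a, (X - C a') := by
  have hex : ∀ a : ℝ, ∃ b, a ∈ A →
      (a < b ∧ (∀ a' ∈ A, a < a' → b < a') ∧ ∑ a' ∈ A, c / (b - a') = 1) := by
    intro a
    by_cases ha : a ∈ A
    · obtain ⟨b, hb⟩ := exists_interlacing_root A hc ha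
      exact ⟨b, fun _ => hb⟩
    · exact ⟨0, fun h => absurd h ha⟩
  choose b hb using hex
  have hinj : Set.InjOn b A := by
    intro a ha a' ha' h
    rcases lt_trichotomy a a' with h1 | h1 | h1
    · exact absurd h (((hb a ha).2.1 a' ha' h1).trans (hb a' ha').1).ne
    · exact h1
    · exact absurd h (((hb a' ha').2.1 a ha h1).trans (hb a ha).1).ne'
  have hnot : ∀ a ∈ A, ∀ a' ∈ A, b a - a' ≠ 0 := by
    intro a ha a' ha' h
    have h := sub_eq_zero.1 h
    rcases lt_or_ge a a' with h1 | h1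
    · exact absurd h ((hb a ha).2.1 a' ha' h1).ne
    · exact absurd h (h1.trans_lt (hb a ha).1).ne'
  rcases A.eq_empty_or_nonempty with rfl | hne
  · exact ⟨b, by simp, by simp, by simp, by simp⟩
  have hcard : 0 < A.card := hne.card_pos
  have hdegS : (∑ a ∈ A, C c * ∏ a' ∈ A.erase a, (X - C a')).degree < A.card := by
    refine (degree_sum_le _ _).trans_lt ((Finset.sup_lt_iff (by simp)).2 fun a ha => ?_)
    rw [degree_C_mul hc.ne', degree_prod]
    simp only [degree_X_sub_C, Finset.sum_const, Finset.card_erase_of_mem ha, nsmul_eq_mul, mul_one]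
    exact_mod_cast Nat.sub_lt hcard one_pos
  have hmon : ∀ v : ℝ → ℝ, (∏ a ∈ A, (X - C (v a))).Monic := fun v =>
    monic_prod_of_monic _ _ fun a _ => monic_X_sub_C _
  have hdeg : ∀ v : ℝ → ℝ, (∏ a ∈ A, (X - C (v a))).degree = (A.card : WithBot ℕ) := fun v => by
    rw [degree_prod]; simp
  have hfac : ∏ a ∈ A, (X - C (b a))
      = ∏ a ∈ A, (X - C a) - ∑ a ∈ A, C c * ∏ a' ∈ A.erase a, (X - C a') := by
    refine eq_of_degree_sub_lt_of_eval_index_eq A hinj ?_ fun a ha => ?_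
    · have e : ∀ p q r : ℝ[X], p - (q - r) = (p - q) + r := fun p q r => by ring
      rw [e]
      refine (degree_add_le _ _).trans_lt (max_lt ?_ hdegS)
      refine (degree_sub_lt_left ?_ ?_ ?_).trans_eq (hdeg b)
      · rw [hdeg, hdeg fun a => a]
      · exact (hmon b).ne_zero
      · rw [(hmon b).leadingCoeff, (hmon fun a => a).leadingCoeff]
    · have e1 : ∀ a' ∈ A, ∏ a'' ∈ A.erase a', (b a - a'')
          = (∏ a'' ∈ A, (b a - a'')) * (b a - a')⁻¹ := by
        intro a' ha'
        rw [← Finset.mul_prod_erase A _ ha']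
        field_simp [hnot a ha a' ha']
      have e2 : ∑ a' ∈ A, c * ∏ a'' ∈ A.erase a', (b a - a'') = ∏ a'' ∈ A, (b a - a'') := by
        rw [← mul_one (∏ a'' ∈ A, (b a - a'')), ← (hb a ha).2.2, Finset.mul_sum]
        refine Finset.sum_congr rfl fun a' ha' => ?_
        rw [e1 a' ha']
        ring
      simp only [eval_prod, eval_sub, eval_finsetSum, eval_mul, eval_X, eval_C]
      rw [e2, sub_self]
      exact Finset.prod_eq_zero ha (sub_self _)
  refine ⟨b, fun a ha => (hb a ha).1, fun a ha => (hb a ha).2.1, ?_, hfac⟩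
  have hco := congrArg (fun p => p.coeff (A.card - 1)) hfac
  simp only [coeff_sub, finsetSum_coeff, coeff_C_mul] at hco
  rw [prod_X_sub_C_coeff_card_pred A b hcard,
    prod_X_sub_C_coeff_card_pred A (fun a => a) hcard] at hco
  have e3 : ∀ a ∈ A, (∏ a' ∈ A.erase a, (X - C a')).coeff (A.card - 1) = 1 := by
    intro a ha
    have hm : (∏ a' ∈ A.erase a, (X - C a')).Monic :=
      monic_prod_of_monic _ _ fun a _ => monic_X_sub_C _
    have hd : (∏ a' ∈ A.erase a, (X - C a')).natDegree = A.card - 1 := by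
      rw [natDegree_prod_of_monic _ _ fun a _ => monic_X_sub_C _]
      simp [Finset.card_erase_of_mem ha]
    rw [← hd]
    exact hm.coeff_natDegree
  have e4 : ∑ a ∈ A, c * (∏ a' ∈ A.erase a, (X - C a')).coeff (A.card - 1) = A.card * c := by
    rw [Finset.sum_congr rfl fun a ha => by rw [e3 a ha, mul_one], Finset.sum_const, nsmul_eq_mul]
  rw [e4] at hco
  rw [Finset.sum_sub_distrib]
  linarith

theorem poissonKernel_eq {η : ℝ} (hη : 0 < η) (x t : ℝ) :
    η / ((x - t) ^ 2 + η ^ 2) = η⁻¹ * (1 + ((x - t) / η) ^ 2)⁻¹ := by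
  field_simp
  ring

theorem integrable_poissonKernel {η : ℝ} (hη : 0 < η) (x : ℝ) :
    Integrable fun t : ℝ => η / ((x - t) ^ 2 + η ^ 2) := by
  simp only [poissonKernel_eq hη]
  exact ((integrable_inv_one_add_sq.comp_div hη.ne').comp_sub_left x).const_mul _

theorem integral_poissonKernel {η : ℝ} (hη : 0 < η) (x : ℝ) :
    ∫ t : ℝ, η / ((x - t) ^ 2 + η ^ 2) = Real.pi := by
  simp only [poissonKernel_eq hη]
  rw [integral_const_mul,
    integral_sub_left_eq_self (fun s : ℝ => (1 + (s / η) ^ 2)⁻¹) volume x,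
    Measure.integral_comp_div (fun s : ℝ => (1 + s ^ 2)⁻¹) η, integral_univ_inv_one_add_sq,
    abs_of_pos hη, smul_eq_mul]
  field_simp

theorem abs_conjPoissonKernel_le {η : ℝ} (hη : 0 < η) (s : ℝ) :
    |s / (s ^ 2 + η ^ 2)| ≤ 1 / η := by
  rw [abs_div, abs_of_pos (by positivity : 0 < s ^ 2 + η ^ 2),
    div_le_div_iff₀ (by positivity) hη]
  nlinarith [sq_abs s, sq_nonneg (|s| - η), abs_nonneg s]

theorem integrable_mul_conjPoissonKernel {f : ℝ → ℝ} (hf : Integrable f) {η : ℝ} (hη : 0 < η)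
    (x : ℝ) : Integrable fun t => f t * ((x - t) / ((x - t) ^ 2 + η ^ 2)) := by
  refine hf.mul_bdd (c := 1 / η) ?_ (.of_forall fun t => ?_)
  · exact (by fun_prop : Measurable fun t : ℝ => (x - t) / ((x - t) ^ 2 + η ^ 2)).aestronglyMeasurable
  · exact abs_conjPoissonKernel_le hη (x - t)

theorem abs_truncatedHilbert_sub_conjPoisson_le {f : ℝ → ℝ} (hf : Integrable f)
    (hf1 : ∀ t, |f t| ≤ 1) {η : ℝ} (hη : 0 < η) (x : ℝ) :
    |Real.pi * truncatedHilbert η f x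
      - ∫ t, f t * ((x - t) / ((x - t) ^ 2 + η ^ 2))| ≤ Real.pi := by
  have hm := measurableSet_truncation η x
  rw [truncatedHilbert, ← mul_assoc, mul_one_div_cancel Real.pi_ne_zero, one_mul,
    ← integral_indicator hm, ← integral_sub ((integrableOn_truncation hf hη x).integrable_indicator hm)
      (integrable_mul_conjPoissonKernel hf hη x), ← Real.norm_eq_abs]
  rw [← integral_poissonKernel hη x]
  refine norm_integral_le_of_norm_le (integrable_poissonKernel hη x) (.of_forall fun t => ?_)
  have hk : 0 < (x - t) ^ 2 + η ^ 2 := by positivity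
  rw [Real.norm_eq_abs]
  by_cases ht : η < |t - x|
  · rw [Set.indicator_of_mem (by exact ht)]
    rw [abs_sub_comm] at ht
    have h0 : x - t ≠ 0 := fun h => by rw [h, abs_zero] at ht; linarith
    have e : f t / (x - t) - f t * ((x - t) / ((x - t) ^ 2 + η ^ 2))
        = f t * (η ^ 2 / ((x - t) * ((x - t) ^ 2 + η ^ 2))) := by
      field_simp
      ring
    rw [e, abs_mul, abs_div, abs_mul, abs_of_pos hk, abs_of_pos (by positivity : 0 < η ^ 2)]
    refine (mul_le_of_le_one_left (by positivity) (hf1 t)).trans ?_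
    have : 0 < |x - t| := hη.trans ht
    rw [div_le_div_iff₀ (by positivity) hk]
    nlinarith [mul_pos hη hk]
  · rw [Set.indicator_of_notMem (by exact ht), zero_sub, abs_neg, abs_mul, abs_div, abs_of_pos hk]
    refine (mul_le_of_le_one_left (by positivity) (hf1 t)).trans ?_
    rw [abs_sub_comm] at ht
    have := not_lt.1 ht
    gcongr

theorem setIntegral_conjPoissonKernel_Icc {a b : ℝ} (hab : a ≤ b) {η : ℝ} (hη : 0 < η) (x : ℝ) :
    ∫ t in Set.Icc a b, (x - t) / ((x - t) ^ 2 + η ^ 2)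
      = (Real.log ((x - a) ^ 2 + η ^ 2) - Real.log ((x - b) ^ 2 + η ^ 2)) / 2 := by
  rw [integral_Icc_eq_integral_Ioc, ← intervalIntegral.integral_of_le hab]
  have hpos : ∀ t : ℝ, (x - t) ^ 2 + η ^ 2 ≠ 0 := fun t => by positivity
  rw [intervalIntegral.integral_eq_sub_of_hasDerivAt
    (f := fun t => -Real.log ((x - t) ^ 2 + η ^ 2) / 2)]
  · ring
  · intro t _
    have h1 : HasDerivAt (fun t : ℝ => (x - t) ^ 2 + η ^ 2) (2 * (x - t) * (-1)) t := by
      simpa using (((hasDerivAt_id t).const_sub x).pow 2).add_const (η ^ 2)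
    refine ((h1.log (hpos t)).neg.div_const 2).congr_deriv ?_
    ring
  · refine Continuous.intervalIntegrable ?_ _ _
    exact (by fun_prop : Continuous fun t : ℝ => x - t).div (by fun_prop) hpos

theorem normSq_sub_ofReal (x η a : ℝ) :
    Complex.normSq (⟨x, η⟩ - (a : ℂ)) = (x - a) ^ 2 + η ^ 2 := by
  simp [Complex.normSq_apply, sq]

open Polynomial in
theorem log_le_sum_log_sub_sum_log {A : Finset ℝ} {b : ℝ → ℝ} {c : ℝ} (hc : 0 < c)
    (hfac : ∏ a ∈ A, (X - C (b a))
      = ∏ a ∈ A, (X - C a) - ∑ a ∈ A, C c * ∏ a' ∈ A.erase a, (X - C a'))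
    {η : ℝ} (hη : 0 < η) {x a₀ : ℝ} (ha₀ : a₀ ∈ A) (hx : |x - a₀| ≤ η) :
    Real.log (c / (2 * η)) ≤ ∑ a ∈ A,
      (Real.log ((x - b a) ^ 2 + η ^ 2) - Real.log ((x - a) ^ 2 + η ^ 2)) / 2 := by
  set z : ℂ := ⟨x, η⟩ with hz
  have hpos : ∀ v : ℝ, 0 < (x - v) ^ 2 + η ^ 2 := fun v => by positivity
  have hz0 : ∀ a : ℝ, z - (a : ℂ) ≠ 0 := fun a h => by
    have := normSq_sub_ofReal x η a
    rw [← hz, h, map_zero] at this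
    exact (hpos a).ne this
  set R : ℂ := 1 - ∑ a ∈ A, (c : ℂ) / (z - a) with hR
  have hzfac : ∏ a ∈ A, (z - (b a : ℂ)) = (∏ a ∈ A, (z - (a : ℂ))) * R := by
    have h := congrArg (aeval z) hfac
    simp only [map_prod, map_sub, map_sum, map_mul, aeval_X, aeval_C, Complex.coe_algebraMap] at h
    rw [h, hR, mul_sub, mul_one, Finset.mul_sum]
    congr 1
    refine Finset.sum_congr rfl fun a ha => ?_
    rw [← Finset.mul_prod_erase A _ ha]
    field_simp [hz0 a]
  have him : c / (2 * η) ≤ R.im := by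
    have e : R.im = ∑ a ∈ A, c * η / ((x - a) ^ 2 + η ^ 2) := by
      rw [hR, Complex.sub_im, Complex.one_im, zero_sub, Complex.im_sum, ← Finset.sum_neg_distrib]
      refine Finset.sum_congr rfl fun a _ => ?_
      rw [Complex.div_im, normSq_sub_ofReal]
      simp [hz]
    rw [e]
    refine le_trans ?_ (Finset.single_le_sum (fun a _ => by have := hpos a; positivity) ha₀)
    rw [div_le_div_iff₀ (by positivity) (hpos _)]
    have : (x - a₀) ^ 2 ≤ η ^ 2 := sq_le_sq' (abs_le.1 hx).1 (abs_le.1 hx).2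
    nlinarith
  have hnR : (c / (2 * η)) ^ 2 ≤ Complex.normSq R := by
    rw [Complex.normSq_apply]
    have : 0 < c / (2 * η) := by positivity
    nlinarith [mul_self_nonneg R.re]
  have hlog : ∀ v : ℝ → ℝ, ∑ a ∈ A, Real.log ((x - v a) ^ 2 + η ^ 2)
      = Real.log (Complex.normSq (∏ a ∈ A, (z - (v a : ℂ)))) := fun v => by
    rw [map_prod, Real.log_prod fun a _ => ?_]
    · simp only [hz, normSq_sub_ofReal]
    · rw [hz, normSq_sub_ofReal]
      exact (hpos _).ne'
  have hRpos : 0 < Complex.normSq R := lt_of_lt_of_le (by positivity) hnR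
  rw [← Finset.sum_div, Finset.sum_sub_distrib, hlog b, hlog fun a => a, hzfac, map_mul,
    Real.log_mul ?_ hRpos.ne', add_sub_cancel_left, le_div_iff₀ two_pos, mul_comm]
  · have h2 : Real.log ((c / (2 * η)) ^ 2) = 2 * Real.log (c / (2 * η)) := by
      rw [Real.log_pow]; norm_num
    rw [← h2]
    exact Real.log_le_log (by positivity) hnR
  · rw [Ne, map_eq_zero]
    exact Finset.prod_ne_zero_iff.2 fun a _ => hz0 a

theorem IsCompact.exists_lipschitz_approx_indicator {G : Set ℝ} (hG : IsCompact G) {ρ : ℝ}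
    (hρ : 0 < ρ) :
    ∃ (g : ℝ → ℝ) (L : NNReal), LipschitzWith L g ∧ (∀ t, 0 ≤ g t) ∧ (∀ t, g t ≤ 1) ∧
      Integrable g ∧ ∫ t, |g t - G.indicator 1 t| ≤ ρ := by
  have hlt : volume G < volume G + ENNReal.ofReal ρ :=
    ENNReal.lt_add_right hG.measure_lt_top.ne (by simpa)
  obtain ⟨κ, hκ, hpos⟩ := ((((tendsto_measure_cthickening_of_isCompact (μ := volume) hG).mono_left
    nhdsWithin_le_nhds).eventually_lt_const hlt).and
      (self_mem_nhdsWithin (s := Set.Ioi (0 : ℝ)))).exists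
  have hpos : 0 < κ := hpos
  set T := Metric.cthickening κ G with hT
  have hTc : IsCompact T := hG.cthickening
  have hGT : G ⊆ T := Metric.self_subset_cthickening G
  set g : ℝ → ℝ := fun t => (thickenedIndicator hpos G t : ℝ) with hg
  have hg0 : ∀ t, 0 ≤ g t := fun t => NNReal.coe_nonneg _
  have hg1 : ∀ t, g t ≤ 1 := fun t => by exact_mod_cast thickenedIndicator_le_one hpos G t
  have hL : LipschitzWith κ.toNNReal⁻¹ g := fun s t =>
    lipschitzWith_thickenedIndicator hpos G s t
  have hout : ∀ t, t ∉ T → g t = 0 := fun t ht => by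
    have := thickenedIndicator_zero hpos G
      (fun h => ht (Metric.thickening_subset_cthickening κ G h))
    simp only [hg, this, NNReal.coe_zero]
  have hin : ∀ t ∈ G, g t = 1 := fun t ht => by
    simp only [hg, thickenedIndicator_one hpos G ht, NNReal.coe_one]
  have hTi : Integrable (T.indicator (1 : ℝ → ℝ)) :=
    (integrable_indicator_iff hTc.measurableSet).2
      (integrableOn_const hTc.measure_lt_top.ne)
  have hGi : Integrable (G.indicator (1 : ℝ → ℝ)) :=
    (integrable_indicator_iff hG.measurableSet).2
      (integrableOn_const hG.measure_lt_top.ne)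
  have hgi : Integrable g := by
    refine hTi.mono' hL.continuous.aestronglyMeasurable (.of_forall fun t => ?_)
    rw [Real.norm_eq_abs, abs_of_nonneg (hg0 t)]
    by_cases ht : t ∈ T
    · simpa [ht] using hg1 t
    · simp [ht, hout t ht]
  refine ⟨g, _, hL, hg0, hg1, hgi, ?_⟩
  have hle : ∀ t, |g t - G.indicator 1 t| ≤ T.indicator 1 t - G.indicator 1 t := by
    intro t
    by_cases ht : t ∈ G
    · simp [ht, hGT ht, hin t ht]
    · by_cases ht' : t ∈ T
      · simpa [ht, ht', abs_of_nonneg (hg0 t)] using hg1 t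
      · simp [ht, ht', hout t ht']
  calc ∫ t, |g t - G.indicator 1 t| ≤ ∫ t, (T.indicator 1 t - G.indicator 1 t) :=
        integral_mono (hgi.sub hGi).abs (hTi.sub hGi) hle
    _ = volume.real T - volume.real G := by
        rw [integral_sub hTi hGi, integral_indicator_one hTc.measurableSet,
          integral_indicator_one hG.measurableSet]
    _ ≤ ρ := by
        have := ENNReal.toReal_mono 
          (ENNReal.add_ne_top.2 ⟨hG.measure_lt_top.ne, ENNReal.ofReal_ne_top⟩) hκ.le
        rw [ENNReal.toReal_add hG.measure_lt_top.ne ENNReal.ofReal_ne_top,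
          ENNReal.toReal_ofReal hρ.le] at this
        rw [Measure.real, Measure.real]
        linarith

theorem exists_lipschitz_truncatedHilbert_large {K : Set ℝ} (hK : IsCompact K)
    (h0 : volume K = 0) (N : ℝ) {δ : ℝ} (hδ : 0 < δ) :
    ∃ (g : ℝ → ℝ) (L : NNReal), LipschitzWith L g ∧ (∀ t, 0 ≤ g t) ∧ (∀ t, g t ≤ 1) ∧
      Integrable g ∧ ∫ t, |g t| ≤ δ ∧ ∃ η, 0 < η ∧ ∀ x ∈ K, N ≤ |truncatedHilbert η g x| := by
  set Λ : ℝ := 2 * Real.exp (Real.pi * (N + 2)) with hΛ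
  have hΛpos : 0 < Λ := by positivity
  obtain ⟨A, h, hpos, hcard, hcov⟩ :=
    hK.exists_finset_card_mul_le h0 (δ := δ / 2 / Λ) (by positivity)
  obtain ⟨b, hab, hord, hsum, hfac⟩ :=
    exists_interlacing_factorization A (c := Λ * h) (by positivity)
  set G : Set ℝ := ⋃ a ∈ A, Set.Icc a (b a) with hGdef
  have hG : IsCompact G := A.isCompact_biUnion fun a _ => isCompact_Icc
  have hdisj : (A : Set ℝ).PairwiseDisjoint fun a => Set.Icc a (b a) := by
    intro a ha a' ha' hne
    refine Set.disjoint_left.2 fun t ht ht' => ?_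
    rcases lt_or_gt_of_ne hne with hlt | hlt
    · exact absurd (ht'.1.trans ht.2) (not_le.2 (hord a ha a' ha' hlt))
    · exact absurd (ht.1.trans ht'.2) (not_le.2 (hord a' ha' a ha hlt))
  have hGi : Integrable (G.indicator (1 : ℝ → ℝ)) :=
    (integrable_indicator_iff hG.measurableSet).2
      (integrableOn_const hG.measure_lt_top.ne)
  have hvol : volume.real G ≤ δ / 2 := by
    rw [hGdef, measureReal_biUnion_finset hdisj (fun a _ => measurableSet_Icc)
      fun a _ => isCompact_Icc.measure_lt_top.ne]
    calc ∑ a ∈ A, volume.real (Set.Icc a (b a)) = ∑ a ∈ A, (b a - a) :=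
          Finset.sum_congr rfl fun a ha => Real.volume_real_Icc_of_le (hab a ha).le
      _ = Λ * (A.card * h) := by rw [hsum]; ring
      _ ≤ Λ * (δ / 2 / Λ) := by gcongr
      _ = δ / 2 := by field_simp
  obtain ⟨g, L, hL, hg0, hg1, hgi, hgG⟩ :=
    hG.exists_lipschitz_approx_indicator (ρ := min (δ / 2) (Real.pi * h)) (by positivity)
  refine ⟨g, L, hL, hg0, hg1, hgi, ?_, h, hpos, fun x hx => ?_⟩
  · have hdi : Integrable fun t => |g t - G.indicator 1 t| := (hgi.sub hGi).abs
    calc ∫ t, |g t| ≤ ∫ t, (|g t - G.indicator 1 t| + G.indicator 1 t) := by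
          refine integral_mono hgi.abs (hdi.add hGi) fun t => ?_
          have h1 : 0 ≤ G.indicator (1 : ℝ → ℝ) t := Set.indicator_nonneg (fun _ _ => zero_le_one) t
          have := abs_add_le (g t - G.indicator 1 t) (G.indicator 1 t)
          rwa [sub_add_cancel, abs_of_nonneg h1] at this
      _ = (∫ t, |g t - G.indicator 1 t|) + volume.real G := by
          rw [integral_add hdi hGi, integral_indicator_one hG.measurableSet]
      _ ≤ δ := by linarith [min_le_left (δ / 2) (Real.pi * h)]
  · obtain ⟨a₀, ha₀, hxa⟩ := hcov x hx
    have hQ : ∫ t, G.indicator (1 : ℝ → ℝ) t * ((x - t) / ((x - t) ^ 2 + h ^ 2))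
        ≤ -(Real.pi * (N + 2)) := by
      have e1 : (fun t => G.indicator (1 : ℝ → ℝ) t * ((x - t) / ((x - t) ^ 2 + h ^ 2)))
          = G.indicator fun t => (x - t) / ((x - t) ^ 2 + h ^ 2) := by
        funext t
        by_cases ht : t ∈ G <;> simp [ht]
      have hint : ∀ a ∈ A, IntegrableOn (fun t => (x - t) / ((x - t) ^ 2 + h ^ 2))
          (Set.Icc a (b a)) := fun a _ => by
        have hne : ∀ t : ℝ, (x - t) ^ 2 + h ^ 2 ≠ 0 := fun t => by positivity
        exact ((by fun_prop : Continuous fun t : ℝ => x - t).div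
          (by fun_prop) hne).continuousOn.integrableOn_Icc
      have h1 := log_le_sum_log_sub_sum_log (by positivity) hfac hpos ha₀ hxa
      have h2 : Λ * h / (2 * h) = Real.exp (Real.pi * (N + 2)) := by
        rw [hΛ]; field_simp
      rw [h2, Real.log_exp] at h1
      rw [e1, integral_indicator hG.measurableSet, hGdef,
        integral_biUnion_finset A (fun a _ => measurableSet_Icc) hdisj hint,
        Finset.sum_congr rfl fun a ha => setIntegral_conjPoissonKernel_Icc (hab a ha).le hpos x,
        le_neg, ← Finset.sum_neg_distrib]
      refine h1.trans_eq (Finset.sum_congr rfl fun a _ => ?_)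
      ring
    have hC := abs_truncatedHilbert_sub_conjPoisson_le hGi (fun t => ?_) hpos x
    · have hD := abs_truncatedHilbert_sub_le hgi hGi hpos x
      have hD1 : (∫ t, |g t - G.indicator 1 t|) / (Real.pi * h) ≤ 1 :=
        (div_le_one (by positivity)).2 (hgG.trans (min_le_right _ _))
      have hC1 := (abs_le.1 hC).2
      have hD2 := (abs_le.1 (hD.trans hD1)).2
      have hH : truncatedHilbert h (G.indicator 1) x ≤ -(N + 1) := by
        have := Real.pi_pos
        by_contra! hcon
        nlinarith
      exact le_abs.2 (.inr (by linarith))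
    · by_cases ht : t ∈ G <;> simp [ht]

/-- Continuous integrable functions whose truncated Hilbert transforms are uniformly bounded. -/
structure HasBoundedTruncations (f : ℝ → ℝ) : Prop where
  continuous : Continuous f
  integrable : Integrable f
  bounded : ∃ M, ∀ ε, 0 < ε → ∀ x, |truncatedHilbert ε f x| ≤ M

theorem HasBoundedTruncations.zero : HasBoundedTruncations fun _ => 0 :=
  ⟨continuous_const, integrable_zero _ _ _, 0, fun ε _ x => by simp [truncatedHilbert]⟩

theorem HasBoundedTruncations.exists_perturbation {e : Set ℝ} (he : IsClosed e)
    (hnull : volume e = 0) {f : ℝ → ℝ} (hf : HasBoundedTruncations f) {d : ℝ} (hd : 0 < d)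
    (n : ℕ) :
    ∃ (f' : ℝ → ℝ) (d' : ℝ), HasBoundedTruncations f' ∧ 0 < d' ∧ d' ≤ d / 2 ∧
      (∀ t, |f' t - f t| ≤ (1 / 2) ^ n) ∧ ∫ t, |f' t - f t| ≤ d ∧
      ∀ F : ℝ → ℝ, Integrable F → ∫ t, |F t - f' t| ≤ 2 * d' →
        ∀ x ∈ e, |x| ≤ n → ∃ ε, 0 < ε ∧ n ≤ |truncatedHilbert ε F x| := by
  obtain ⟨M, hM⟩ := hf.bounded
  set α : ℝ := (1 / 2) ^ n with hα
  have hαpos : 0 < α := by positivity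
  have hα1 : α ≤ 1 := pow_le_one₀ (by norm_num) (by norm_num)
  obtain ⟨g, L, hL, hg0, hg1, hgi, hgd, η, hη, hlarge⟩ :=
    exists_lipschitz_truncatedHilbert_large (K := e ∩ Set.Icc (-n : ℝ) n)
      (isCompact_Icc.inter_left he) (measure_mono_null Set.inter_subset_left hnull)
      ((M + n + 1) / α) hd
  have hag : Integrable fun t => α * g t := hgi.const_mul α
  have hH : ∀ ε, 0 < ε → ∀ x, truncatedHilbert ε (fun t => f t + α * g t) x
      = truncatedHilbert ε f x + α * truncatedHilbert ε g x := fun ε hε x => by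
    rw [truncatedHilbert_add hf.integrable hag hε, truncatedHilbert_const_mul]
  have hdiff : ∀ t, |f t + α * g t - f t| = α * |g t| := fun t => by
    rw [add_sub_cancel_left, abs_mul, abs_of_pos hαpos]
  refine ⟨fun t => f t + α * g t, min (d / 2) (Real.pi * η / 2), ⟨?_, ?_, ?_⟩, by positivity,
    min_le_left _ _, fun t => ?_, ?_, fun F hF hFd x hx hxn => ⟨η, hη, ?_⟩⟩
  · exact hf.continuous.add (continuous_const.mul hL.continuous)
  · exact hf.integrable.add hag
  · refine ⟨M + α * ((2 * L + ∫ t, |g t|) / Real.pi), fun ε hε x => ?_⟩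
    rw [hH ε hε]
    refine (abs_add_le _ _).trans (add_le_add (hM ε hε x) ?_)
    rw [abs_mul, abs_of_pos hαpos]
    exact mul_le_mul_of_nonneg_left (hL.abs_truncatedHilbert_le hgi hε x) hαpos.le
  · rw [hdiff, abs_of_nonneg (hg0 t)]
    exact mul_le_of_le_one_right hαpos.le (hg1 t)
  · simp only [hdiff]
    rw [integral_const_mul]
    exact (mul_le_of_le_one_left (integral_nonneg fun t => abs_nonneg _) hα1).trans hgd
  · have h1 := abs_truncatedHilbert_sub_le hF (hf.integrable.add hag) hη x
    have h2 : (∫ t, |F t - (f t + α * g t)|) / (Real.pi * η) ≤ 1 := by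
      refine (div_le_one (by positivity)).2 (hFd.trans ?_)
      linarith [min_le_right (d / 2) (Real.pi * η / 2)]
    have h3 := hlarge x ⟨hx, abs_le.1 hxn⟩
    rw [div_le_iff₀' hαpos] at h3
    have h4 := h1.trans h2
    have h5 : truncatedHilbert η (f + fun t => α * g t) x
        = truncatedHilbert η f x + α * truncatedHilbert η g x := hH η hη x
    rw [h5] at h4
    have h6 := hM η hη x
    have h7 : α * |truncatedHilbert η g x| ≤ |truncatedHilbert η F x|
        + |truncatedHilbert η F x - (truncatedHilbert η f x + α * truncatedHilbert η g x)|
        + |truncatedHilbert η f x| := by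
      rw [← abs_of_pos hαpos, ← abs_mul, abs_of_pos hαpos]
      calc |α * truncatedHilbert η g x|
          = |truncatedHilbert η F x - (truncatedHilbert η F x - (truncatedHilbert η f x
              + α * truncatedHilbert η g x)) - truncatedHilbert η f x| := by congr 1; ring
        _ ≤ _ := (abs_sub _ _).trans (add_le_add_left (abs_sub _ _) _)
    linarith

theorem integrable_tsum_of_integral_abs_le {u : ℕ → ℝ → ℝ} (hc : ∀ k, Continuous (u k))
    (hi : ∀ k, Integrable (u k)) {w v : ℕ → ℝ} (hw : Summable w) (huw : ∀ k t, |u k t| ≤ w k)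
    (hv : Summable v) (huv : ∀ k, ∫ t, |u k t| ≤ v k) :
    Integrable (fun t => ∑' k, u k t) ∧ ∫ t, |∑' k, u k t| ≤ ∑' k, v k := by
  have hcont : Continuous fun t => ∑' k, u k t := continuous_tsum hc hw huw
  have hv0 : ∀ k, 0 ≤ v k := fun k => (integral_nonneg fun t => abs_nonneg _).trans (huv k)
  have hle : ∫⁻ t, ‖∑' k, u k t‖ₑ ≤ ENNReal.ofReal (∑' k, v k) := by
    calc ∫⁻ t, ‖∑' k, u k t‖ₑ ≤ ∫⁻ t, ∑' k, ‖u k t‖ₑ := lintegral_mono fun t => enorm_tsum_le_tsum_enorm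
      _ = ∑' k, ∫⁻ t, ‖u k t‖ₑ := lintegral_tsum fun k => (hc k).enorm.aemeasurable
      _ ≤ ∑' k, ENNReal.ofReal (v k) := by
          refine ENNReal.tsum_le_tsum fun k => ?_
          rw [← ofReal_integral_norm_eq_lintegral_enorm (hi k)]
          exact ENNReal.ofReal_le_ofReal (huv k)
      _ = _ := (ENNReal.ofReal_tsum_of_nonneg hv0 hv).symm
  have hint : Integrable fun t => ∑' k, u k t :=
    ⟨hcont.aestronglyMeasurable, hle.trans_lt ENNReal.ofReal_lt_top⟩
  refine ⟨hint, ?_⟩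
  rw [← ofReal_integral_norm_eq_lintegral_enorm hint,
    ENNReal.ofReal_le_ofReal_iff (tsum_nonneg hv0)] at hle
  exact hle

theorem theorem2 (e : Set ℝ) (he : IsClosed e) (hnull : volume e = 0) :
    ∃ f : ℝ → ℝ, Continuous f ∧ Integrable f volume ∧
      ∀ x ∈ e, maximalHilbert f x = ∞ := by
  have step : ∀ (n : ℕ) (s : {p : (ℝ → ℝ) × ℝ // HasBoundedTruncations p.1 ∧ 0 < p.2}),
      ∃ s' : {p : (ℝ → ℝ) × ℝ // HasBoundedTruncations p.1 ∧ 0 < p.2},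
        s'.1.2 ≤ s.1.2 / 2 ∧ (∀ t, |s'.1.1 t - s.1.1 t| ≤ (1 / 2) ^ n) ∧
        ∫ t, |s'.1.1 t - s.1.1 t| ≤ s.1.2 ∧
        ∀ F : ℝ → ℝ, Integrable F → ∫ t, |F t - s'.1.1 t| ≤ 2 * s'.1.2 →
          ∀ x ∈ e, |x| ≤ n → ∃ ε, 0 < ε ∧ n ≤ |truncatedHilbert ε F x| := by
    rintro n ⟨⟨f, d⟩, hf, hd⟩
    obtain ⟨f', d', hf', hd', h⟩ := hf.exists_perturbation he hnull hd n
    exact ⟨⟨⟨f', d'⟩, hf', hd'⟩, h⟩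
  choose next hnext using step
  let s : ℕ → {p : (ℝ → ℝ) × ℝ // HasBoundedTruncations p.1 ∧ 0 < p.2} := fun n =>
    Nat.rec ⟨⟨fun _ => 0, 1⟩, HasBoundedTruncations.zero, one_pos⟩ next n
  let f : ℕ → ℝ → ℝ := fun n => (s n).1.1
  let d : ℕ → ℝ := fun n => (s n).1.2
  have hnice : ∀ n, HasBoundedTruncations (f n) := fun n => (s n).2.1
  have hhalf : ∀ n, d (n + 1) ≤ d n / 2 := fun n => (hnext n (s n)).1
  have hsup : ∀ n t, |f (n + 1) t - f n t| ≤ (1 / 2) ^ n := fun n => (hnext n (s n)).2.1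
  have hL1 : ∀ n, ∫ t, |f (n + 1) t - f n t| ≤ d n := fun n => (hnext n (s n)).2.2.1
  have hgood : ∀ n, ∀ F : ℝ → ℝ, Integrable F → ∫ t, |F t - f (n + 1) t| ≤ 2 * d (n + 1) →
      ∀ x ∈ e, |x| ≤ n → ∃ ε, 0 < ε ∧ n ≤ |truncatedHilbert ε F x| :=
    fun n => (hnext n (s n)).2.2.2
  have hdecay : ∀ n k, d (k + n) ≤ d n * (1 / 2) ^ k := by
    intro n k
    induction k with
    | zero => simp
    | succ k ih =>
      rw [Nat.add_right_comm, pow_succ]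
      linarith [hhalf (k + n)]
  have hgeo : Summable fun k : ℕ => ((1 : ℝ) / 2) ^ k := summable_geometric_two
  have hsum : ∀ t, Summable fun k => f (k + 1) t - f k t := fun t =>
    Summable.of_norm_bounded hgeo fun k => hsup k t
  let F : ℝ → ℝ := fun t => ∑' k, (f (k + 1) t - f k t)
  have hFcont : Continuous F :=
    continuous_tsum (fun k => (hnice (k + 1)).continuous.sub (hnice k).continuous) hgeo hsup
  have htail : ∀ n t, F t - f n t = ∑' k, (f (k + n + 1) t - f (k + n) t) := by
    intro n t
    have h1 := (hsum t).sum_add_tsum_nat_add n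
    rw [Finset.sum_range_sub (fun k => f k t)] at h1
    have h2 : f 0 t = 0 := rfl
    have h3 : F t = ∑' k, (f (k + 1) t - f k t) := rfl
    rw [h3, ← h1, h2]
    ring
  have hclose : ∀ n, Integrable (fun t => F t - f n t) ∧ ∫ t, |F t - f n t| ≤ 2 * d n := by
    intro n
    simp only [htail n]
    have h := integrable_tsum_of_integral_abs_le
      (u := fun k t => f (k + n + 1) t - f (k + n) t) (v := fun k => d n * (1 / 2) ^ k)
      (fun k => (hnice (k + n + 1)).continuous.sub (hnice (k + n)).continuous)
      (fun k => (hnice (k + n + 1)).integrable.sub (hnice (k + n)).integrable)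
      ((summable_nat_add_iff n).2 hgeo) (fun k => hsup (k + n)) (hgeo.mul_left (d n))
      (fun k => (hL1 (k + n)).trans (hdecay n k))
    rwa [tsum_mul_left, tsum_geometric_two, mul_comm (d n)] at h
  have hFint : Integrable F := by
    refine ((hclose 0).1.add (hnice 0).integrable).congr (.of_forall fun t => ?_)
    exact sub_add_cancel _ _
  refine ⟨F, hFcont, hFint, fun x hx => ENNReal.eq_top_of_forall_nnreal_le fun r => ?_⟩
  obtain ⟨n, hn⟩ := exists_nat_ge (max |x| r)
  obtain ⟨ε, hε, hlarge⟩ := hgood n F hFint (hclose (n + 1)).2 x hx ((le_max_left _ _).trans hn)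
  calc (r : ℝ≥0∞) = ENNReal.ofReal r := (ENNReal.ofReal_coe_nnreal).symm
    _ ≤ ENNReal.ofReal |truncatedHilbert ε F x| :=
        ENNReal.ofReal_le_ofReal ((le_max_right _ _).trans (hn.trans hlarge))
    _ ≤ maximalHilbert F x :=
        le_iSup₂ (f := fun (ε : ℝ) (_ : 0 < ε) => ENNReal.ofReal |truncatedHilbert ε F x|) ε hε
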